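/- **Setting.** Let $\mathscr H_A=\mathbb C^{d_A}$, $\mathscr H_B=\mathbb C^{d_B}$, let $\hat N_A,\hat N_B$ be Hermitian operators on them, and let $\hat N$ be either $\hat N_A\otimes\hat N_B$ or $\hat N_A\otimes 1_B+1_A\otimes\hat N_B$. Let $\mathscr D$ be the set of density matrices on $\mathscr H_A\otimes\mathscr H_B$, and let $\mathscr K=\mathscr D^{\mathrm{sep}}_{\hat N}$ be the set of separable states $\rho=\sum_i p_i\,\rho_{A,i}\otimes\rho_{B,i}$ (convex combinations of products of density matrices) with $[\rho,\hat N]=0$. The number entanglement of $\rho\in\mathscr D$ is $$\Delta S_{\hat N_A}(\rho)=S\Big(\sum_{x}\Pi_x\rho\,\Pi_x\Big)-S(\rho),\qquad S(\rho)=-\mathrm{Tr}(\rho\log\rho),$$ where $\Pi_x$ runs over the spectral projectors of $\hat N_A\otimes 1_B$. *Purifying manifold.* For a pure state $\Psi$ (unit vector up to phase) of $(\mathscr H_A\otimes\mathscr H_B)^{\otimes 2}$ let $\tau(\Psi)\in\mathscr D$ be the partial trace of $|\Psi\rangle\langle\Psi|$ over the second copy of $\mathscr H_A\otimes\mathscr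 H_B$, and let $\chi=\{\Psi:\tau(\Psi)\in\mathscr K\}$, a subset of projective space. Let $D$ be the largest $d$ such that some point of $\chi$ has an open neighbourhood in $\chi$ homeomorphic to $\mathbb R^d$, and let $\chi_0$ be the closure of the set of points of $\chi$ having an open neighbourhood in $\chi$ homeomorphic to $\mathbb R^D$. *Shells and measures.* Let $\chi_0=\bigcup_{i=1}^M\mathcal B_i$, where each $\mathcal B_i$ is homeomorphic (for instance diffeomorphic), by a fixed map, to a closed ball $B^D(R_i)\subset\mathbb R^D$ with $R_i>0$, where $\sum_i\mathrm{vol}\,B^D(R_i)=1$, and where the intersections $\mathcal B_i\cap\mathcal B_j$, $i\ne j$, are null sets for the pulled-back Euclidean measures. For each $i$ let $B^D(R_i)$ be the union of countably many concentric shells $\{a_{ik}\le\|x\|\le b_{ik}\}$, $0\le a_{ik}<b_{ik}\le R_i$, any two of which meet in a null set, and let $\mathcal S_{ik}\subseteq\mathcal B_i$ be the corresponding shells. Let $\nu_{ik}$ be the normalized pulled-back Euclidean measure on $\mathcal S_{ik}$, let $\tilde\mu=\sum_{ik}w_{ik}\nu_{ik}$ with $w_{ik}$ the Euclidean volume of the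 shell $\{a_{ik}\le\|x\|\le b_{ik}\}$, let $\mu=\tau_*\tilde\mu$, and put $$v_{ik}=\mu(\tau(\mathcal S_{ik})),\qquad m_{ik}=v_{ik}^{-1}\int_{\tau(\mathcal S_{ik})}\Delta S_{\hat N_A}(\sigma)\,d\mu(\sigma).$$ **Proposition.** For all $i,k$: if there is a state $\rho\in\tau(\mathcal S_{ik})$ with $\Delta S_{\hat N_A}(\rho)>0$, then $m_{ik}>0$. Moreover, $m_{ik}=0$ if and only if $\Delta S_{\hat N_A}(\rho)=0$ for all $\rho\in\tau(\mathcal S_{ik})$. -/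

import Mathlib

open scoped ComplexOrder Kronecker

noncomputable section

namespace NumberEntanglement

open MeasureTheory Matrix

/-! ### States, partial trace, entropy -/

/-- Density matrices (states) on the Hilbert space `ℂⁿ`. -/
def DensityMatrix (n : Type) [Fintype n] : Type :=
  {ρ : Matrix n n ℂ // ρ.PosSemidef ∧ ρ.trace = 1}

instance (n : Type) [Fintype n] : TopologicalSpace (DensityMatrix n) :=
  inferInstanceAs (TopologicalSpace {ρ : Matrix n n ℂ // ρ.PosSemidef ∧ ρ.trace = 1})

instance (n : Type) [Fintype n] : MeasurableSpace (DensityMatrix n) := borel _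

instance (n : Type) [Fintype n] : BorelSpace (DensityMatrix n) := ⟨rfl⟩

/-- The partial trace over the second tensor factor. -/
def partialTrace {m n : Type} [Fintype n] (M : Matrix (m × n) (m × n) ℂ) : Matrix m m ℂ :=
  Matrix.of fun i j => ∑ k, M (i, k) (j, k)

theorem partialTrace_posSemidef {m n : Type} [Fintype m] [Fintype n]
    {M : Matrix (m × n) (m × n) ℂ} (hM : M.PosSemidef) : (partialTrace M).PosSemidef := by
  have h : partialTrace M = ∑ k, M.submatrix (fun i => (i, k)) (fun i => (i, k)) := by
    ext i j
    simp [partialTrace, Matrix.sum_apply]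
  rw [h]
  exact Matrix.posSemidef_sum _ fun k _ => hM.submatrix _

theorem partialTrace_trace {m n : Type} [Fintype m] [Fintype n]
    (M : Matrix (m × n) (m × n) ℂ) : (partialTrace M).trace = M.trace := by
  simp [partialTrace, Matrix.trace, Fintype.sum_prod_type]

/-- The reduced state on the first tensor factor. -/
def reduce {m n : Type} [Fintype m] [Fintype n] (ρ : DensityMatrix (m × n)) : DensityMatrix m :=
  ⟨partialTrace ρ.1, partialTrace_posSemidef ρ.2.1, (partialTrace_trace ρ.1).trans ρ.2.2⟩

/-- The von Neumann entropy `S(ρ) = - Tr (ρ log ρ)`. -/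
def vonNeumannEntropy {n : Type} [Fintype n] [DecidableEq n] (ρ : Matrix n n ℂ) : ℝ :=
  -(ρ * cfc Real.log ρ).trace.re

/-- The spectral projector of the Hermitian matrix `M` onto the sector (eigenspace) of charge `x`;
it is `0` when `x` is not an eigenvalue of `M`. -/
def sectorProjector {n : Type} [Fintype n] [DecidableEq n] (M : Matrix n n ℂ) (x : ℝ) :
    Matrix n n ℂ :=
  cfc (fun t : ℝ => if t = x then (1 : ℝ) else 0) M

/-- The state after a nonselective measurement of the observable `M`: the sum of `Π ρ Π` over the
spectral projectors `Π` of `M`. -/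
def measure {n : Type} [Fintype n] [DecidableEq n] (M ρ : Matrix n n ℂ) : Matrix n n ℂ :=
  ∑ x ∈ M.finite_real_spectrum.toFinset, sectorProjector M x * ρ * sectorProjector M x

/-- The number entanglement of the state `ρ` with respect to the local observable `NA`: the increase
of the von Neumann entropy under a nonselective measurement of `NA ⊗ 1`. -/
def numberEntanglement {α β : Type} [Fintype α] [Fintype β] [DecidableEq α] [DecidableEq β]
    (NA : Matrix α α ℂ) (ρ : DensityMatrix (α × β)) : ℝ :=
  vonNeumannEntropy (measure (NA ⊗ₖ (1 : Matrix β β ℂ)) ρ.1) - vonNeumannEntropy ρ.1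

/-- The separable states `∑ pᵢ ρ_{A,i} ⊗ ρ_{B,i}` that commute with the observable `N`. -/
def symmetricSeparableSet {α β : Type} [Fintype α] [Fintype β]
    (N : Matrix (α × β) (α × β) ℂ) : Set (DensityMatrix (α × β)) :=
  {ρ | ρ.1 ∈ convexHull ℝ
        {M | ∃ (ρA : DensityMatrix α) (ρB : DensityMatrix β), M = ρA.1 ⊗ₖ ρB.1} ∧
      ρ.1 * N = N * ρ.1}

/-! ### Purifications and the purifying manifold -/

/-- The projective space `P(ℂⁿ)` of pure states, i.e. unit vectors of `ℂⁿ` up to a phase. -/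
def PureState (n : Type) [Fintype n] : Type :=
  Projectivization ℂ (EuclideanSpace ℂ n)

/-- The quotient topology. -/
instance (n : Type) [Fintype n] : TopologicalSpace (PureState n) :=
  inferInstanceAs
    (TopologicalSpace (Quotient (projectivizationSetoid ℂ (EuclideanSpace ℂ n))))

instance (n : Type) [Fintype n] : MeasurableSpace (PureState n) := borel _

instance (n : Type) [Fintype n] : BorelSpace (PureState n) := ⟨rfl⟩

/-- The density matrix `|ψ⟩⟨ψ| / ‖ψ‖²` of a nonzero vector `ψ`. -/
def rankOne {n : Type} [Fintype n] (ψ : {v : EuclideanSpace ℂ n // v ≠ 0}) : DensityMatrix n :=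
  ⟨((‖ψ.1‖ ^ 2)⁻¹ : ℝ) • Matrix.vecMulVec ψ.1.ofLp (star ψ.1.ofLp), by
    refine ⟨(Matrix.posSemidef_vecMulVec_self_star _).smul (by positivity), ?_⟩
    have h0 : (‖ψ.1‖ ^ 2 : ℝ) ≠ 0 := pow_ne_zero _ (norm_ne_zero_iff.mpr ψ.2)
    have h1 : (Matrix.vecMulVec ψ.1.ofLp (star ψ.1.ofLp)).trace = ((‖ψ.1‖ ^ 2 : ℝ) : ℂ) := by
      rw [EuclideanSpace.norm_sq_eq]
      simp [Matrix.trace, Matrix.vecMulVec_apply, Complex.mul_conj, Complex.normSq_eq_norm_sq]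
    rw [Matrix.trace_smul, h1, Complex.real_smul, ← Complex.ofReal_mul, inv_mul_cancel₀ h0,
      Complex.ofReal_one]⟩

/-- The embedding `j` of pure states into density matrices, `[ψ] ↦ |ψ⟩⟨ψ|` for `‖ψ‖ = 1`. -/
def PureState.toDensity {n : Type} [Fintype n] : PureState n → DensityMatrix n :=
  Projectivization.lift rankOne (by
    intro a b t h
    have ht : t ≠ 0 := by
      rintro rfl
      exact a.2 (by simpa using h)
    apply Subtype.ext
    ext i j
    have hb : (‖b.1‖ : ℂ) ≠ 0 := by exact_mod_cast norm_ne_zero_iff.mpr b.2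
    have hc : (‖t‖ : ℂ) ≠ 0 := by exact_mod_cast norm_ne_zero_iff.mpr ht
    have hm : t * (starRingEnd ℂ) t = (‖t‖ : ℂ) ^ 2 := by
      rw [Complex.mul_conj, Complex.normSq_eq_norm_sq]; push_cast; ring
    simp only [rankOne, h, norm_smul, Matrix.smul_apply, Matrix.vecMulVec_apply, Pi.star_apply,
      PiLp.smul_apply, smul_eq_mul, star_mul', RCLike.star_def, Complex.real_smul]
    push_cast
    field_simp
    linear_combination (b.1.ofLp i * (starRingEnd ℂ) (b.1.ofLp j)) * hm)

/-- The map `τ`: a pure state of the canonical purification space `ℂⁿ ⊗ ℂⁿ` is sent to its reduced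
state on the first copy of `ℂⁿ`. -/
def tau {n : Type} [Fintype n] (Ψ : PureState (n × n)) : DensityMatrix n :=
  reduce Ψ.toDensity

/-- The set `χ` of all purifications, in `ℂⁿ ⊗ ℂⁿ` and up to a phase, of the states in `K`. -/
def purificationSet {n : Type} [Fintype n] (K : Set (DensityMatrix n)) :
    Set (PureState (n × n)) :=
  {Ψ | tau Ψ ∈ K}

/-- The point `x` has an open neighbourhood homeomorphic to `ℝᵈ`. -/
def HasEuclideanNhd {X : Type} [TopologicalSpace X] (x : X) (d : ℕ) : Prop :=
  ∃ U : Set X, IsOpen U ∧ x ∈ U ∧ Nonempty (U ≃ₜ EuclideanSpace ℝ (Fin d))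

/-- The purification dimension of `K`: the largest local Euclidean dimension of points of `χ`. (The
set of local dimensions is bounded, and it is empty only if `χ` has no Euclidean point, in which
case the value is `0`.) -/
def purificationDim {n : Type} [Fintype n] (K : Set (DensityMatrix n)) : ℕ :=
  sSup {d : ℕ | ∃ Ψ : purificationSet K, HasEuclideanNhd Ψ d}

/-- The purifying manifold `χ₀` of `K`: the closure of the set of those points of `χ` whose local
Euclidean dimension (within `χ`) is the purification dimension. -/
def purifyingManifold {n : Type} [Fintype n] (K : Set (DensityMatrix n)) :
    Set (PureState (n × n)) :=
  closure (Subtype.val '' {Ψ : purificationSet K | HasEuclideanNhd Ψ (purificationDim K)})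

/-! ### Coverings by spherical shells and the induced measures -/

/-- The spherical shell `{x : a ≤ ‖x‖ ≤ b}` inside the closed ball of radius `R` about `0` in
`ℝᴰ`. -/
def annulus (D : ℕ) (R a b : ℝ) : Set (Metric.closedBall (0 : EuclideanSpace ℝ (Fin D)) R) :=
  {x | a ≤ ‖x.1‖ ∧ ‖x.1‖ ≤ b}

/-- Euclidean (Lebesgue) measure on the closed ball of radius `R` about `0` in `ℝᴰ`. -/
def ballMeasure (D : ℕ) (R : ℝ) :
    Measure (Metric.closedBall (0 : EuclideanSpace ℝ (Fin D)) R) :=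
  Measure.comap Subtype.val volume

/-- A covering of the subset `Y` of a topological space by almost-nowhere-intersecting
`D`-dimensional spherical shells: `Y` is the union of finitely many domains `Bᵢ`, each parametrized
homeomorphically by a closed ball of `ℝᴰ`, the volumes of these balls add up to `1`, distinct
domains meet in null sets, and each ball is the union of countably many concentric shells of
positive thickness, distinct ones meeting in null sets. -/
structure ShellCovering {X : Type} [TopologicalSpace X] (Y : Set X) (D : ℕ) where
  /-- the number of domains -/
  M : ℕ
  /-- the radii of the balls -/
  radius : Fin M → ℝ
  radius_pos : ∀ i, 0 < radius i
  /-- the parametrizations of the domains -/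
  param : ∀ i, Metric.closedBall (0 : EuclideanSpace ℝ (Fin D)) (radius i) → X
  isEmbedding : ∀ i, Topology.IsEmbedding (param i)
  iUnion_range : ⋃ i, Set.range (param i) = Y
  sum_volume :
    ∑ i, volume (Metric.closedBall (0 : EuclideanSpace ℝ (Fin D)) (radius i)) = 1
  volume_overlap : ∀ i j, i ≠ j → ballMeasure D (radius i) (param i ⁻¹' Set.range (param j)) = 0
  /-- the indices of the shells of the `i`-th domain -/
  κ : Fin M → Type
  countable : ∀ i, Countable (κ i)
  /-- the inner radii of the shells -/
  inner : ∀ i, κ i → ℝ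
  /-- the outer radii of the shells -/
  outer : ∀ i, κ i → ℝ
  inner_nonneg : ∀ i k, 0 ≤ inner i k
  inner_lt_outer : ∀ i k, inner i k < outer i k
  outer_le_radius : ∀ i k, outer i k ≤ radius i
  iUnion_annulus : ∀ i, ⋃ k, annulus D (radius i) (inner i k) (outer i k) = Set.univ
  volume_annulus_overlap : ∀ i k l, k ≠ l →
    ballMeasure D (radius i) (annulus D (radius i) (inner i k) (outer i k) ∩
      annulus D (radius i) (inner i l) (outer i l)) = 0

namespace ShellCovering

section

variable {X : Type} [TopologicalSpace X] {Y : Set X} {D : ℕ} (C : ShellCovering Y D)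

/-- The model of the `k`-th shell of the `i`-th domain, in the closed ball. -/
def model (i : Fin C.M) (k : C.κ i) :
    Set (Metric.closedBall (0 : EuclideanSpace ℝ (Fin D)) (C.radius i)) :=
  annulus D (C.radius i) (C.inner i k) (C.outer i k)

/-- The shell `S_{ik}`. -/
def shell (i : Fin C.M) (k : C.κ i) : Set X :=
  C.param i '' C.model i k

/-- The measure `ν_{ik}`: the normalized, rotation-invariant restriction of Euclidean measure to the
shell, transported to `S_{ik}`. -/
def shellMeasure [MeasurableSpace X] (i : Fin C.M) (k : C.κ i) : Measure X :=
  (ProbabilityTheory.cond (ballMeasure D (C.radius i)) (C.model i k)).map (C.param i)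

/-- The normalized measure `∑_{ik} v_{ik} ν_{ik}`, where the weight `v_{ik}` is the Euclidean volume
of the shell. -/
def totalMeasure [MeasurableSpace X] : Measure X :=
  Measure.sum fun p : Σ i, C.κ i =>
    ballMeasure D (C.radius p.1) (C.model p.1 p.2) • C.shellMeasure p.1 p.2

end

section

variable {n : Type} [Fintype n] {Y : Set (PureState (n × n))} {D : ℕ} (C : ShellCovering Y D)

/-- The measure `μ` on states: the push-forward under `τ` of the measure on purifications. -/
def stateMeasure : Measure (DensityMatrix n) :=
  C.totalMeasure.map tau

/-- The mean of `f` over `τ(S_{ik})`: the integral of `f` over `τ(S_{ik})` with respect to `μ`,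
divided by `v_{ik} = μ(τ(S_{ik}))`. -/
def mean (f : DensityMatrix n → ℝ) (i : Fin C.M) (k : C.κ i) : ℝ :=
  (C.stateMeasure.real (tau '' C.shell i k))⁻¹ *
    ∫ ρ in tau '' C.shell i k, f ρ ∂C.stateMeasure

end

end ShellCovering

end NumberEntanglement

end

open scoped ComplexOrder Kronecker

noncomputable section

namespace NumberEntanglement

open MeasureTheory Matrix

/-! ### Entropy through eigenvalues, and its continuity -/

section Entropy

variable {n : Type} [Fintype n] [DecidableEq n]

/-! A nonnegative continuous function that is positive at one point of the support of a measure has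
positive integral. So three facts suffice. Nonnegativity: in the eigenbases of a state and of its
pinching, the new eigenvalues are doubly stochastic averages of the old ones, so Jensen for the
concave function `-x log x` gives `vonNeumannEntropy_le_measure`. Continuity: entropy is the trace
of a continuous function of the state, and pinching is linear. Full support
(`stateMeasure_inter_pos`): an open set meeting `τ(S_{ik})` pulls back to a relatively open set
meeting a closed shell. The open shell is dense there when `D > 0`, so the pullback has positive
volume, and `μ` dominates the push-forward of that volume. -/

open scoped Matrix.Norms.L2Operator in
theorem continuousOn_cfc_isHermitian {f : ℝ → ℝ} (hf : Continuous f) :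
    ContinuousOn (fun A : Matrix n n ℂ => cfc f A) {A | A.IsHermitian} :=
  -- The C⋆-norm serves only this continuity theorem; its topology is the entrywise one.
  ContinuousOn.cfc_of_mem_nhdsSet (X := Matrix n n ℂ) (A := Matrix n n ℂ)
    (p := IsSelfAdjoint) (s := Set.univ) f (t := {A | A.IsHermitian}) Filter.univ_mem
    continuousOn_id (fun _ hx => hx) hf.continuousOn

/-- Trades `log`, discontinuous at `0`, for the continuous `negMulLog`. The spectrum is finite, so
every function is continuous on it and the functional calculus is multiplicative. -/
theorem vonNeumannEntropy_eq_trace_cfc {ρ : Matrix n n ℂ} (hρ : ρ.IsHermitian) :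
    vonNeumannEntropy ρ = (cfc Real.negMulLog ρ).trace.re := by
  have hc (g : ℝ → ℝ) : ContinuousOn g (spectrum ℝ ρ) := ρ.finite_real_spectrum.continuousOn g
  have h : ρ * cfc Real.log ρ = -cfc Real.negMulLog ρ := by
    conv_lhs => enter [1]; rw [← cfc_id' ℝ ρ hρ.isSelfAdjoint]
    rw [← cfc_mul (fun x => x) Real.log ρ (hc _) (hc _), ← cfc_neg]
    congr 1
    ext x
    simp [Real.negMulLog]
  simp [vonNeumannEntropy, h]

theorem trace_cfc {A : Matrix n n ℂ} (hA : A.IsHermitian) (f : ℝ → ℝ) :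
    (cfc f A).trace.re = ∑ i, f (hA.eigenvalues i) := by
  rw [hA.cfc_eq, IsHermitian.cfc, Unitary.conjStarAlgAut_apply, trace_mul_comm, ← mul_assoc,
    Unitary.coe_star_mul_self, one_mul]
  simp [trace]

theorem continuousOn_vonNeumannEntropy :
    ContinuousOn (vonNeumannEntropy (n := n)) {A | A.IsHermitian} := by
  have h : ContinuousOn (fun A : Matrix n n ℂ => (cfc Real.negMulLog A).trace.re)
      {A | A.IsHermitian} :=
    Complex.continuous_re.comp_continuousOn
      (continuous_id.matrix_trace.comp_continuousOn
        (continuousOn_cfc_isHermitian Real.continuous_negMulLog))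
  exact h.congr fun A hA => vonNeumannEntropy_eq_trace_cfc hA

end Entropy

/-! ### Pinching increases entropy -/

section Pinching

variable {n : Type} [Fintype n]

theorem isHermitian_pinching {ι : Type} {s : Finset ι} {P : ι → Matrix n n ℂ}
    (hP : ∀ x, (P x).IsHermitian) {A : Matrix n n ℂ} (hA : A.IsHermitian) :
    (∑ x ∈ s, P x * A * P x).IsHermitian := by
  unfold Matrix.IsHermitian
  rw [conjTranspose_sum]
  refine Finset.sum_congr rfl fun x _ => ?_
  rw [conjTranspose_mul, conjTranspose_mul, (hP x).eq, hA.eq, mul_assoc]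

variable [DecidableEq n]

theorem mul_diagonal_mul_conjTranspose_apply_self (X : Matrix n n ℂ) (d : n → ℝ) (j : n) :
    (X * diagonal (fun k => (d k : ℂ)) * Xᴴ) j j =
      ((∑ k, Complex.normSq (X j k) * d k : ℝ) : ℂ) := by
  rw [mul_apply]
  push_cast
  refine Finset.sum_congr rfl fun k _ => ?_
  rw [mul_diagonal, conjTranspose_apply, RCLike.star_def, Complex.normSq_eq_conj_mul_self]
  ring

theorem sum_normSq_row (X : Matrix n n ℂ) (j : n) :
    ((∑ k, Complex.normSq (X j k) : ℝ) : ℂ) = (X * Xᴴ) j j := by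
  simpa using (mul_diagonal_mul_conjTranspose_apply_self X 1 j).symm

theorem sum_normSq_col (X : Matrix n n ℂ) (k : n) :
    ((∑ j, Complex.normSq (X j k) : ℝ) : ℂ) = (Xᴴ * X) k k := by
  simpa using sum_normSq_row Xᴴ k

/-- The Peierls inequality for a pinching: a concave function of the eigenvalues increases in
total. -/
theorem sum_eigenvalues_le_of_pinching {ι : Type} {s : Finset ι} {P : ι → Matrix n n ℂ}
    (hP : ∀ x, (P x).IsHermitian) (hsum : ∑ x ∈ s, P x * P x = 1) {A B : Matrix n n ℂ}
    (hA : A.IsHermitian) (hB : B.IsHermitian) (hAB : B = ∑ x ∈ s, P x * A * P x)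
    {t : Set ℝ} (ht : ∀ i, hA.eigenvalues i ∈ t) {f : ℝ → ℝ} (hf : ConcaveOn ℝ t f) :
    ∑ i, f (hA.eigenvalues i) ≤ ∑ i, f (hB.eigenvalues i) := by
  let U : Matrix n n ℂ := (hB.eigenvectorUnitary).1
  let V : Matrix n n ℂ := (hA.eigenvectorUnitary).1
  have hUU : U * Uᴴ = 1 := Unitary.coe_mul_star_self _
  have hUU' : Uᴴ * U = 1 := Unitary.coe_star_mul_self _
  have hVV : V * Vᴴ = 1 := Unitary.coe_mul_star_self _
  have hVV' : Vᴴ * V = 1 := Unitary.coe_star_mul_self _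
  have hAd : A = V * diagonal (fun k => (hA.eigenvalues k : ℂ)) * Vᴴ := by
    conv_lhs => rw [hA.spectral_theorem, Unitary.conjStarAlgAut_apply]
    rfl
  have hBd : B = U * diagonal (fun k => (hB.eigenvalues k : ℂ)) * Uᴴ := by
    conv_lhs => rw [hB.spectral_theorem, Unitary.conjStarAlgAut_apply]
    rfl
  let X : ι → Matrix n n ℂ := fun x => Uᴴ * P x * V
  have hXH (x) : (X x)ᴴ = Vᴴ * P x * U := by
    simp only [X, conjTranspose_mul, conjTranspose_conjTranspose, (hP x).eq, mul_assoc]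
  -- `W` is the transition matrix between the two eigenbases. Its rows and columns sum to `1`
  -- because the `P x * P x` sum to `1` and `U`, `V` are unitary.
  let W : n → n → ℝ := fun j k => ∑ x ∈ s, Complex.normSq (X x j k)
  have hW0 (j k) : 0 ≤ W j k := Finset.sum_nonneg fun x _ => Complex.normSq_nonneg _
  have hrow (j) : ∑ k, W j k = 1 := by
    have h : ∑ x ∈ s, X x * (X x)ᴴ = 1 := by
      calc ∑ x ∈ s, X x * (X x)ᴴ = ∑ x ∈ s, Uᴴ * (P x * P x) * U := by
            refine Finset.sum_congr rfl fun x _ => ?_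
            rw [hXH]
            calc Uᴴ * P x * V * (Vᴴ * P x * U) = Uᴴ * P x * (V * Vᴴ) * P x * U := by noncomm_ring
              _ = _ := by rw [hVV]; noncomm_ring
        _ = 1 := by rw [← Finset.sum_mul, ← Finset.mul_sum, hsum, mul_one, hUU']
    have : ((∑ k, W j k : ℝ) : ℂ) = 1 := by
      simp only [W]
      rw [Finset.sum_comm, Complex.ofReal_sum]
      simp_rw [sum_normSq_row]
      rw [← Matrix.sum_apply, h, one_apply_eq]
    exact_mod_cast this
  have hcol (k) : ∑ j, W j k = 1 := by
    have h : ∑ x ∈ s, (X x)ᴴ * X x = 1 := by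
      calc ∑ x ∈ s, (X x)ᴴ * X x = ∑ x ∈ s, Vᴴ * (P x * P x) * V := by
            refine Finset.sum_congr rfl fun x _ => ?_
            rw [hXH]
            calc Vᴴ * P x * U * (Uᴴ * P x * V) = Vᴴ * P x * (U * Uᴴ) * P x * V := by noncomm_ring
              _ = _ := by rw [hUU]; noncomm_ring
        _ = 1 := by rw [← Finset.sum_mul, ← Finset.mul_sum, hsum, mul_one, hVV']
    have : ((∑ j, W j k : ℝ) : ℂ) = 1 := by
      simp only [W]
      rw [Finset.sum_comm, Complex.ofReal_sum]
      simp_rw [sum_normSq_col]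
      rw [← Matrix.sum_apply, h, one_apply_eq]
    exact_mod_cast this
  -- Diagonal entries of the pinching, written in the eigenbasis of `B`.
  have heig (j) : hB.eigenvalues j = ∑ k, W j k * hA.eigenvalues k := by
    have h : diagonal (fun k => (hB.eigenvalues k : ℂ)) =
        ∑ x ∈ s, X x * diagonal (fun k => (hA.eigenvalues k : ℂ)) * (X x)ᴴ := by
      calc diagonal (fun k => (hB.eigenvalues k : ℂ))
          = (Uᴴ * U) * diagonal (fun k => (hB.eigenvalues k : ℂ)) * (Uᴴ * U) := by
            rw [hUU', one_mul, mul_one]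
        _ = Uᴴ * (U * diagonal (fun k => (hB.eigenvalues k : ℂ)) * Uᴴ) * U := by
            noncomm_ring
        _ = Uᴴ * (∑ x ∈ s, P x * A * P x) * U := by rw [← hBd, hAB]
        _ = ∑ x ∈ s, Uᴴ * (P x * A * P x) * U := by rw [Finset.mul_sum, Finset.sum_mul]
        _ = _ := by
            refine Finset.sum_congr rfl fun x _ => ?_
            rw [hXH]
            conv_lhs => rw [hAd]
            simp only [X]
            noncomm_ring
    have h2 := congrFun (congrFun h j) j
    rw [diagonal_apply_eq, Matrix.sum_apply] at h2
    simp_rw [mul_diagonal_mul_conjTranspose_apply_self] at h2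
    rw [← Complex.ofReal_sum, Complex.ofReal_inj] at h2
    rw [h2, Finset.sum_comm]
    simp only [W, Finset.sum_mul]
  -- Column sums spread each term over `j`; Jensen then applies in each row.
  calc ∑ k, f (hA.eigenvalues k) = ∑ k, (∑ j, W j k) * f (hA.eigenvalues k) := by
        simp [hcol]
    _ = ∑ j, ∑ k, W j k * f (hA.eigenvalues k) := by
        simp_rw [Finset.sum_mul]
        rw [Finset.sum_comm]
    _ ≤ ∑ j, f (hB.eigenvalues j) := by
        refine Finset.sum_le_sum fun j _ => ?_
        have := hf.le_map_sum (t := Finset.univ) (w := W j) (p := hA.eigenvalues)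
          (fun k _ => hW0 j k) (hrow j) (fun k _ => ht k)
        simpa [heig j] using this

theorem sectorProjector_isHermitian (M : Matrix n n ℂ) (x : ℝ) :
    (sectorProjector M x).IsHermitian :=
  cfc_predicate (R := ℝ) (p := IsSelfAdjoint) _ M

/-- Indicators of points are idempotent, and those of the spectral points sum to `1` on the
spectrum. -/
theorem sum_sectorProjector_mul_self {M : Matrix n n ℂ} (hM : M.IsHermitian) :
    ∑ x ∈ M.finite_real_spectrum.toFinset, sectorProjector M x * sectorProjector M x = 1 := by
  have hc (g : ℝ → ℝ) : ContinuousOn g (spectrum ℝ M) := M.finite_real_spectrum.continuousOn g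
  have hM' : IsSelfAdjoint M := hM
  have h (x : ℝ) : sectorProjector M x * sectorProjector M x =
      cfc (fun t : ℝ => if t = x then (1 : ℝ) else 0) M := by
    rw [sectorProjector, ← cfc_mul _ _ M (hc _) (hc _)]
    congr 1
    ext t
    split_ifs <;> simp
  simp_rw [h]
  rw [← cfc_sum _ _ _ (fun _ _ => hc _), ← cfc_one ℝ M]
  refine cfc_congr fun t ht => ?_
  simp [Finset.sum_apply, ht]

theorem measure_isHermitian (M : Matrix n n ℂ) {ρ : Matrix n n ℂ} (hρ : ρ.IsHermitian) :
    (measure M ρ).IsHermitian :=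
  isHermitian_pinching (sectorProjector_isHermitian M) hρ

/-- A nonselective measurement does not decrease the von Neumann entropy. -/
theorem vonNeumannEntropy_le_measure {M ρ : Matrix n n ℂ} (hM : M.IsHermitian)
    (hρ : ρ.PosSemidef) : vonNeumannEntropy ρ ≤ vonNeumannEntropy (measure M ρ) := by
  have hρ' := measure_isHermitian M hρ.1
  rw [vonNeumannEntropy_eq_trace_cfc hρ.1, vonNeumannEntropy_eq_trace_cfc hρ',
    trace_cfc hρ.1, trace_cfc hρ']
  exact sum_eigenvalues_le_of_pinching (sectorProjector_isHermitian M)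
    (sum_sectorProjector_mul_self hM) hρ.1 hρ' rfl hρ.eigenvalues_nonneg
    Real.concaveOn_negMulLog

theorem continuous_measure (M : Matrix n n ℂ) : Continuous (measure M) := by
  unfold measure
  fun_prop

end Pinching

/-! ### Nonnegativity and continuity of the number entanglement -/

section NumberEntanglement

variable {α β : Type} [Fintype α] [Fintype β] [DecidableEq α] [DecidableEq β]

theorem numberEntanglement_nonneg {NA : Matrix α α ℂ} (hNA : NA.IsHermitian)
    (ρ : DensityMatrix (α × β)) : 0 ≤ numberEntanglement NA ρ := by
  refine sub_nonneg.2 (vonNeumannEntropy_le_measure ?_ ρ.2.1)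
  unfold Matrix.IsHermitian
  rw [conjTranspose_kronecker, hNA.eq, conjTranspose_one]

theorem continuous_numberEntanglement (NA : Matrix α α ℂ) :
    Continuous (numberEntanglement NA : DensityMatrix (α × β) → ℝ) := by
  have hv : Continuous (fun ρ : DensityMatrix (α × β) => ρ.1) := continuous_subtype_val
  exact (continuousOn_vonNeumannEntropy.comp_continuous ((continuous_measure _).comp hv)
      fun ρ => measure_isHermitian _ ρ.2.1.1).sub
    (continuousOn_vonNeumannEntropy.comp_continuous hv fun ρ => ρ.2.1.1)

end NumberEntanglement

/-! ### The map `τ` is continuous -/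

section Tau

variable {n : Type} [Fintype n]

instance : T2Space (DensityMatrix n) :=
  inferInstanceAs (T2Space {ρ : Matrix n n ℂ // ρ.PosSemidef ∧ ρ.trace = 1})

theorem continuous_rankOne : Continuous (rankOne (n := n)) := by
  refine Continuous.subtype_mk ?_ _
  have h1 : Continuous fun ψ : {v : EuclideanSpace ℂ n // v ≠ 0} => (‖ψ.1‖ ^ 2)⁻¹ :=
    Continuous.inv₀ (by fun_prop) fun ψ => pow_ne_zero _ (norm_ne_zero_iff.mpr ψ.2)
  have h2 : Continuous fun ψ : {v : EuclideanSpace ℂ n // v ≠ 0} => ψ.1.ofLp :=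
    (PiLp.continuous_ofLp 2 _).comp continuous_subtype_val
  exact h1.smul (h2.matrix_vecMulVec h2.star)

theorem continuous_toDensity : Continuous (PureState.toDensity (n := n)) :=
  Continuous.quotient_lift continuous_rankOne _

theorem continuous_reduce {m : Type} [Fintype m] : Continuous (reduce (m := m) (n := n)) := by
  refine Continuous.subtype_mk ?_ _
  have hv : Continuous (fun ρ : DensityMatrix (m × n) => ρ.1) := continuous_subtype_val
  refine continuous_matrix fun i j => ?_
  exact continuous_finsetSum _ fun k _ => hv.matrix_elem _ _

theorem continuous_tau : Continuous (tau (n := n)) :=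
  continuous_reduce.comp continuous_toDensity

end Tau

/-! ### Euclidean measure on shells -/

section Annulus

variable {D : ℕ} {R a b : ℝ}

theorem ballMeasure_apply (s : Set (Metric.closedBall (0 : EuclideanSpace ℝ (Fin D)) R)) :
    ballMeasure D R s = volume (Subtype.val '' s) :=
  comap_subtype_coe_apply Metric.isClosed_closedBall.measurableSet _ _

theorem isClosed_annulus : IsClosed (annulus D R a b) :=
  (isClosed_le continuous_const continuous_subtype_val.norm).inter
    (isClosed_le continuous_subtype_val.norm continuous_const)

instance : IsFiniteMeasure (ballMeasure D R) :=
  ⟨by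
    rw [ballMeasure_apply, Set.image_univ, Subtype.range_coe]
    exact measure_closedBall_lt_top⟩

/-- A shell of positive thickness charges all its relatively open nonempty subsets. -/
theorem ballMeasure_inter_annulus_pos (ha : 0 ≤ a) (hab : a < b) (hb : b ≤ R)
    {V : Set (Metric.closedBall (0 : EuclideanSpace ℝ (Fin D)) R)} (hV : IsOpen V)
    (h : (annulus D R a b ∩ V).Nonempty) : 0 < ballMeasure D R (annulus D R a b ∩ V) := by
  obtain ⟨x, ⟨hax, hxb⟩, hxV⟩ := h
  obtain ⟨V', hV', rfl⟩ := isOpen_induced_iff.1 hV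
  rw [ballMeasure_apply]
  rcases subsingleton_or_nontrivial (EuclideanSpace ℝ (Fin D)) with hD | hD
  -- For `D = 0` the open shell is empty, but the single point has positive volume.
  · refine lt_of_lt_of_le (isOpen_univ.measure_pos volume ⟨0, trivial⟩) (measure_mono fun y _ => ?_)
    exact ⟨x, ⟨⟨hax, hxb⟩, hxV⟩, Subsingleton.elim _ _⟩
  · obtain ⟨e, he, hxe⟩ : ∃ e : EuclideanSpace ℝ (Fin D), ‖e‖ = 1 ∧ ‖x.1‖ • e = x.1 := by
      by_cases hx : x.1 = 0
      · obtain ⟨e, he⟩ := exists_norm_eq (EuclideanSpace ℝ (Fin D)) zero_le_one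
        exact ⟨e, he, by simp [hx]⟩
      · have hx' : ‖x.1‖ ≠ 0 := norm_ne_zero_iff.2 hx
        exact ⟨‖x.1‖⁻¹ • x.1, by simp [norm_smul, hx'],
          by rw [smul_smul, mul_inv_cancel₀ hx', one_smul]⟩
    -- Moving `x` slightly along its ray `ℝ e` reaches the open shell without leaving `V'`; this is
    -- where `a < b` matters.
    have hr : ‖x.1‖ ∈ closure (Set.Ioo a b) := by
      rw [closure_Ioo hab.ne]
      exact ⟨hax, hxb⟩
    have hcont : Continuous fun r : ℝ => r • e := by fun_prop
    obtain ⟨r, hrV, har, hrb⟩ := mem_closure_iff.1 hr _ (hV'.preimage hcont)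
      (show ‖x.1‖ • e ∈ V' by rwa [hxe])
    have hopen : IsOpen (V' ∩ {y | a < ‖y‖ ∧ ‖y‖ < b}) :=
      hV'.inter ((isOpen_lt continuous_const continuous_norm).inter
        (isOpen_lt continuous_norm continuous_const))
    have hnorm : ‖r • e‖ = r := by
      rw [norm_smul, he, mul_one, Real.norm_of_nonneg (ha.trans har.le)]
    refine lt_of_lt_of_le (hopen.measure_pos volume ⟨r • e, hrV, ?_, ?_⟩)
      (measure_mono fun y hy => ?_)
    · rwa [hnorm]
    · rwa [hnorm]
    · exact ⟨⟨y, mem_closedBall_zero_iff.2 (hy.2.2.le.trans hb)⟩,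
        ⟨⟨hy.2.1.le, hy.2.2.le⟩, hy.1⟩, rfl⟩

end Annulus

/-! ### The induced measures of a shell covering -/

namespace ShellCovering

section

variable {X : Type} [TopologicalSpace X] {Y : Set X} {D : ℕ} (C : ShellCovering Y D)

theorem isCompact_shell (i : Fin C.M) (k : C.κ i) : IsCompact (C.shell i k) :=
  isClosed_annulus.isCompact.image (C.isEmbedding i).continuous

theorem measurableSet_model (i : Fin C.M) (k : C.κ i) : MeasurableSet (C.model i k) :=
  isClosed_annulus.measurableSet

theorem tsum_volume_model (i : Fin C.M) :
    ∑' k, ballMeasure D (C.radius i) (C.model i k) = ballMeasure D (C.radius i) Set.univ := by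
  have := C.countable i
  rw [← C.iUnion_annulus i, measure_iUnion₀ (fun k l hkl => C.volume_annulus_overlap i k l hkl)
    fun k => (C.measurableSet_model i k).nullMeasurableSet]
  rfl

variable [MeasurableSpace X] [BorelSpace X]

/-- The weight cancels the normalization of `ν_{ik}`. -/
theorem volume_smul_shellMeasure_apply (i : Fin C.M) (k : C.κ i) {s : Set X}
    (hs : MeasurableSet s) :
    (ballMeasure D (C.radius i) (C.model i k) • C.shellMeasure i k) s =
      ballMeasure D (C.radius i) (C.model i k ∩ C.param i ⁻¹' s) := by
  rw [Measure.smul_apply, shellMeasure,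
    Measure.map_apply (C.isEmbedding i).continuous.measurable hs, smul_eq_mul, mul_comm]
  exact ProbabilityTheory.cond_mul_eq_inter' (C.measurableSet_model i k) (measure_ne_top _ _) _

/-- One summand is at most the sum, so overlaps between shells can only add mass. -/
theorem le_totalMeasure (i : Fin C.M) (k : C.κ i) {s : Set X} (hs : MeasurableSet s) :
    ballMeasure D (C.radius i) (C.model i k ∩ C.param i ⁻¹' s) ≤ C.totalMeasure s := by
  rw [← C.volume_smul_shellMeasure_apply i k hs]
  exact Measure.le_sum (fun p : Σ i, C.κ i =>
    ballMeasure D (C.radius p.1) (C.model p.1 p.2) • C.shellMeasure p.1 p.2) ⟨i, k⟩ s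

theorem totalMeasure_univ : C.totalMeasure Set.univ = 1 := by
  rw [totalMeasure, Measure.sum_apply _ MeasurableSet.univ]
  simp_rw [C.volume_smul_shellMeasure_apply _ _ MeasurableSet.univ, Set.preimage_univ,
    Set.inter_univ]
  rw [ENNReal.tsum_sigma', tsum_fintype, ← C.sum_volume]
  refine Finset.sum_congr rfl fun i _ => ?_
  rw [C.tsum_volume_model, ballMeasure_apply, Set.image_univ, Subtype.range_coe]

instance : IsProbabilityMeasure C.totalMeasure := ⟨C.totalMeasure_univ⟩

end

section

variable {n : Type} [Fintype n] {Y : Set (PureState (n × n))} {D : ℕ} (C : ShellCovering Y D)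

instance : IsProbabilityMeasure C.stateMeasure :=
  Measure.isProbabilityMeasure_map continuous_tau.measurable.aemeasurable

theorem isCompact_tau_image_shell (i : Fin C.M) (k : C.κ i) :
    IsCompact (tau '' C.shell i k) :=
  (C.isCompact_shell i k).image continuous_tau

/-- Every point of `τ(S_{ik})` is in the support of the restriction of `μ` to `τ(S_{ik})`. -/
theorem stateMeasure_inter_pos (i : Fin C.M) (k : C.κ i) {U : Set (DensityMatrix n)}
    (hU : IsOpen U) (h : (U ∩ tau '' C.shell i k).Nonempty) :
    0 < C.stateMeasure (U ∩ tau '' C.shell i k) := by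
  obtain ⟨_, hxU, _, ⟨x, hx, rfl⟩, rfl⟩ := h
  have hS : MeasurableSet (U ∩ tau '' C.shell i k) :=
    hU.measurableSet.inter (C.isCompact_tau_image_shell i k).isClosed.measurableSet
  rw [stateMeasure, Measure.map_apply continuous_tau.measurable hS]
  refine lt_of_lt_of_le ?_ (C.le_totalMeasure i k (continuous_tau.measurable hS))
  refine lt_of_lt_of_le (ballMeasure_inter_annulus_pos (C.inner_nonneg i k)
    (C.inner_lt_outer i k) (C.outer_le_radius i k)
    (hU.preimage (continuous_tau.comp (C.isEmbedding i).continuous)) ⟨x, hx, hxU⟩)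
    (measure_mono ?_)
  rintro y ⟨hy, hyU⟩
  exact ⟨hy, hyU, _, ⟨y, hy, rfl⟩, rfl⟩

theorem mean_pos {f : DensityMatrix n → ℝ} (hf : Continuous f) (hf0 : ∀ ρ, 0 ≤ f ρ)
    (i : Fin C.M) (k : C.κ i) (h : ∃ ρ ∈ tau '' C.shell i k, 0 < f ρ) : 0 < C.mean f i k := by
  obtain ⟨ρ, hρ, hfρ⟩ := h
  have hpos : 0 < C.stateMeasure (tau '' C.shell i k) := by
    simpa using C.stateMeasure_inter_pos i k isOpen_univ ⟨ρ, trivial, hρ⟩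
  refine mul_pos (inv_pos.2 (ENNReal.toReal_pos hpos.ne' (measure_ne_top _ _))) ?_
  -- Positivity of the integral becomes positive mass of the support of `f` in `τ(S_{ik})`, an open
  -- set by continuity.
  rw [setIntegral_pos_iff_support_of_nonneg_ae (Filter.Eventually.of_forall hf0)
    (hf.continuousOn.integrableOn_compact (C.isCompact_tau_image_shell i k))]
  exact C.stateMeasure_inter_pos i k hf.isOpen_support ⟨ρ, hfρ.ne', hρ⟩

theorem mean_eq_zero {f : DensityMatrix n → ℝ} (i : Fin C.M) (k : C.κ i)
    (h : ∀ ρ ∈ tau '' C.shell i k, f ρ = 0) : C.mean f i k = 0 := by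
  rw [mean, setIntegral_eq_zero_of_forall_eq_zero h, mul_zero]

end

end ShellCovering

end NumberEntanglement

end

open scoped Kronecker in
open NumberEntanglement in
theorem propositionT {α β : Type} [Fintype α] [Fintype β] [DecidableEq α] [DecidableEq β]
    (NA : Matrix α α ℂ) (NB : Matrix β β ℂ) (hNA : NA.IsHermitian) (hNB : NB.IsHermitian)
    (N : Matrix (α × β) (α × β) ℂ)
    (hN : N = NA ⊗ₖ NB ∨ N = NA ⊗ₖ (1 : Matrix β β ℂ) + (1 : Matrix α α ℂ) ⊗ₖ NB)
    (C : ShellCovering (purifyingManifold (symmetricSeparableSet N))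
      (purificationDim (symmetricSeparableSet N)))
    (i : Fin C.M) (k : C.κ i) :
    ((∃ ρ ∈ tau '' C.shell i k, 0 < numberEntanglement NA ρ) →
        0 < C.mean (numberEntanglement NA) i k) ∧
      (C.mean (numberEntanglement NA) i k = 0 ↔
        ∀ ρ ∈ tau '' C.shell i k, numberEntanglement NA ρ = 0) := by
  have hpos := C.mean_pos (continuous_numberEntanglement NA) (numberEntanglement_nonneg hNA) i k
  refine ⟨hpos, fun h ρ hρ => ?_, C.mean_eq_zero i k⟩
  by_contra hne
  exact (hpos ⟨ρ, hρ, (numberEntanglement_nonneg hNA ρ).lt_of_ne' hne⟩).ne' h
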